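/- Let $\mathcal Y$ be a complex Hilbert space, let $M$ be a positive selfadjoint, possibly unbounded, operator in $\mathcal Y$ (so $(Mx,x)\ge 0$ for $x\in\mathcal D(M)$; a nontrivial null-space is allowed), and let $C$ be a bounded accretive operator on $\mathcal Y$, i.e. $\operatorname{Re}(Cx,x)\ge 0$ for all $x$. Let $M^{1/2}$ be the positive selfadjoint square root of $M$, and let $$\mathcal A^+=\begin{pmatrix}-C & -M^{1/2}\\ M^{1/2} & 0\end{pmatrix},\qquad \mathcal D(\mathcal A^+)=\mathcal D(M^{1/2})\oplus\mathcal D(M^{1/2}),$$ in the Hilbert space $\mathcal Y\oplus\mathcal Y$. Write $\mathcal N(\cdot)$ for the null-space of an operator. Then $$\mathcal N(\mathcal A^+)\supseteq\bigl(\mathcal N(C)\cap\mathcal N(M)\bigr)\oplus\mathcal N(M).$$ If, in addition, $C$ is sectorial, i.e. there is $N>0$ with $|\operatorname{Im}(Cx,x)|\le N\operatorname{Re}(Cx,x)$ for all $x\in\mathcal Y$, then $$\mathcal N(\mathcal A^+)=\bigl(\mathcal N(C)\cap\mathcal N(M)\bigr)\oplus\mathcal N(M).$$ -/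

import Mathlib

namespace DampedSystem

variable {E : Type*} [NormedAddCommGroup E] [InnerProductSpace ℂ E]

/-- The null-space `{x ∈ D(T) | T x = 0}` of a partially defined linear operator. -/
def nullSpace (T : E →ₗ.[ℂ] E) : Submodule ℂ E :=
  (LinearMap.ker T.toFun).map T.domain.subtype

/-- Positivity of an operator: `(Tx, x) ≥ 0` for `x ∈ D(T)`; a nontrivial null-space is allowed. -/
def IsPositive (T : E →ₗ.[ℂ] E) : Prop :=
  ∀ x : T.domain, 0 ≤ (inner ℂ (x : E) (T x)).re

/-- `S` is a positive selfadjoint square root of `M`: `S` is selfadjoint and positive, and `S ∘ S`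
(with its natural domain `{x ∈ D(S) | S x ∈ D(S)}`) is equal to `M`, domains included. -/
def IsPositiveSqrt [CompleteSpace E] (S M : E →ₗ.[ℂ] E) : Prop :=
  IsSelfAdjoint S ∧ IsPositive S ∧
    ∀ x y : E, (x, y) ∈ M.graph ↔ ∃ z : E, (x, z) ∈ S.graph ∧ (z, y) ∈ S.graph

open Classical in
/-- The square root `M^{1/2}` of a positive selfadjoint operator `M`, that is, its unique positive
selfadjoint square root (with the value `0` at operators that have no such root). -/
noncomputable def sqrtOp [CompleteSpace E] (M : E →ₗ.[ℂ] E) : E →ₗ.[ℂ] E :=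
  if h : ∃ S : E →ₗ.[ℂ] E, IsPositiveSqrt S M then Classical.choose h else 0

/-- A bounded operator is accretive if `Re (Cx, x) ≥ 0` for all `x`. -/
def IsAccretive (C : E →L[ℂ] E) : Prop :=
  ∀ x : E, 0 ≤ (inner ℂ x (C x)).re

/-- A bounded operator is sectorial (with vertex `0`) if its numerical range lies in a sector
`|Im z| ≤ N Re z` with some `N > 0`. -/
def IsSectorial (C : E →L[ℂ] E) : Prop :=
  ∃ N : ℝ, 0 < N ∧ ∀ x : E, |(inner ℂ x (C x)).im| ≤ N * (inner ℂ x (C x)).re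

/-- The orthogonal sum `U ⊕ V` as a subspace of the Hilbert space `E ⊕ E`. -/
def orthSum (U V : Submodule ℂ E) : Submodule ℂ (WithLp 2 (E × E)) :=
  (U.prod V).comap (WithLp.linearEquiv 2 ℂ (E × E)).toLinearMap

/-- The block operator `[[-C, -S], [S, 0]]` in the Hilbert space `E ⊕ E`, with the domain
`D(S) ⊕ D(S)`. -/
noncomputable def blockOp (S : E →ₗ.[ℂ] E) (C : E →L[ℂ] E) :
    WithLp 2 (E × E) →ₗ.[ℂ] WithLp 2 (E × E) where
  domain := orthSum S.domain S.domain
  toFun :=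
    { toFun := fun x =>
        WithLp.toLp 2 (-(C x.1.fst) - S ⟨x.1.snd, x.2.2⟩, S ⟨x.1.fst, x.2.1⟩)
      map_add' := by
        intro x y
        have h1 : S ⟨(x + y).1.fst, (x + y).2.1⟩ = S ⟨x.1.fst, x.2.1⟩ + S ⟨y.1.fst, y.2.1⟩ := by
          rw [← LinearPMap.map_add]; rfl
        have h2 : S ⟨(x + y).1.snd, (x + y).2.2⟩ = S ⟨x.1.snd, x.2.2⟩ + S ⟨y.1.snd, y.2.2⟩ := by
          rw [← LinearPMap.map_add]; rfl
        rw [h1, h2, ← WithLp.toLp_add, Prod.mk_add_mk]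
        congr 2
        simp only [Submodule.coe_add, WithLp.add_fst, map_add]
        abel
      map_smul' := by
        intro c x
        have h1 : S ⟨(c • x).1.fst, (c • x).2.1⟩ = c • S ⟨x.1.fst, x.2.1⟩ := by
          rw [← LinearPMap.map_smul]; rfl
        have h2 : S ⟨(c • x).1.snd, (c • x).2.2⟩ = c • S ⟨x.1.snd, x.2.2⟩ := by
          rw [← LinearPMap.map_smul]; rfl
        rw [h1, h2, RingHom.id_apply, ← WithLp.toLp_smul, Prod.smul_mk]
        congr 2
        simp only [Submodule.coe_smul, WithLp.smul_fst, map_smul, smul_sub, smul_neg] }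

/-- The operator `𝒜⁺ = [[-C, -M^{1/2}], [M^{1/2}, 0]]` in the Hilbert space `E ⊕ E`, with the
domain `D(M^{1/2}) ⊕ D(M^{1/2})`. -/
noncomputable def Aplus [CompleteSpace E] (M : E →ₗ.[ℂ] E) (C : E →L[ℂ] E) :
    WithLp 2 (E × E) →ₗ.[ℂ] WithLp 2 (E × E) :=
  blockOp (sqrtOp M) C

end DampedSystem

open scoped InnerProductSpace ComplexOrder LinearPMap

namespace DampedSystem

variable {E : Type*} [NormedAddCommGroup E] [InnerProductSpace ℂ E]

/-! Write `S` for the root of `M`. A pair `(x, y)` is annihilated by the block operator iff `S x =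
0` and `S y = -C x`. Symmetry then gives `(x, C x) = -(S x, y) = 0`, and a sectorial `C` kills every
zero of its form, so `C x = 0` and `S y = 0`. Finally `S` and `M` have the same null-space. Since
`sqrtOp` defaults to `0`, the existence of a root must be proved; uniqueness is not needed. The root
is built from bounded operators via the resolvent `(1 + M)⁻¹`. -/

theorem mem_nullSpace_iff (T : E →ₗ.[ℂ] E) (x : E) : x ∈ nullSpace T ↔ (x, (0 : E)) ∈ T.graph := by
  rw [LinearPMap.mem_graph_iff]
  constructor
  · rintro ⟨y, hy, rfl⟩
    exact ⟨y, rfl, hy⟩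
  · rintro ⟨y, rfl, hy⟩
    exact ⟨y, hy, rfl⟩

theorem IsPositive.re_inner_nonneg {T : E →ₗ.[ℂ] E} (hT : IsPositive T) {x y : E}
    (h : (x, y) ∈ T.graph) : 0 ≤ (inner ℂ x y).re := by
  obtain ⟨x, rfl, rfl⟩ := (LinearPMap.mem_graph_iff T).1 h
  exact hT x

/-- Positivity makes the cross term of `‖x + T x‖²` nonnegative, so `1 + T` is bounded below. -/
theorem norm_le_norm_fst_add_snd {T : E →ₗ.[ℂ] E} (hpos : IsPositive T) {p : E × E} (hp : p ∈ T.graph) :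
    ‖p‖ ≤ ‖p.1 + p.2‖ := by
  have h := hpos.re_inner_nonneg (x := p.1) (y := p.2) hp
  have h2 := norm_add_sq (𝕜 := ℂ) p.1 p.2
  simp only [RCLike.re_to_complex] at h2
  rw [Prod.norm_def]
  apply max_le <;> refine (pow_le_pow_iff_left₀ (norm_nonneg _) (norm_nonneg _) two_ne_zero).1 ?_ <;>
    nlinarith [sq_nonneg ‖p.1‖, sq_nonneg ‖p.2‖]

/-- The map `(x, T x) ↦ x + T x` on the graph of `T`. -/
noncomputable def graphSum (T : E →ₗ.[ℂ] E) : T.graph →L[ℂ] E :=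
  (ContinuousLinearMap.fst ℂ E E + ContinuousLinearMap.snd ℂ E E) ∘L T.graph.subtypeL

theorem graphSum_apply (T : E →ₗ.[ℂ] E) (p : T.graph) : graphSum T p = p.1.1 + p.1.2 := rfl

theorem antilipschitzWith_graphSum {T : E →ₗ.[ℂ] E} (hpos : IsPositive T) : AntilipschitzWith 1 (graphSum T) :=
  ContinuousLinearMap.antilipschitz_of_bound _ fun p => by
    simpa [graphSum_apply] using norm_le_norm_fst_add_snd hpos p.2

/-! ### Resolvent of a positive selfadjoint operator -/

section SelfAdjoint

variable [CompleteSpace E] {T : E →ₗ.[ℂ] E}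

/-- The graph equals its own adjoint: one direction is symmetry, the other is maximality. -/
theorem mem_graph_iff_of_isSelfAdjoint (hT : IsSelfAdjoint T) (x y : E) :
    (x, y) ∈ T.graph ↔ ∀ a b, (a, b) ∈ T.graph → inner ℂ b x = inner ℂ a y := by
  have h : T.graph = T.graph.adjoint := by
    rw [← LinearPMap.adjoint_graph_eq_graph_adjoint hT.dense_domain,
      LinearPMap.isSelfAdjoint_def.1 hT]
  conv_lhs => rw [h]
  simp only [Submodule.mem_adjoint_iff, sub_eq_zero]

theorem surjective_graphSum (hT : IsSelfAdjoint T) (hpos : IsPositive T) :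
    Function.Surjective (graphSum T) := by
  have : CompleteSpace T.graph := hT.isClosed.completeSpace_coe
  have hc : IsClosed ((LinearMap.range (graphSum T : T.graph →ₗ[ℂ] E) : Submodule ℂ E) : Set E) := by
    have := (antilipschitzWith_graphSum hpos).isClosed_range (graphSum T).uniformContinuous
    exact this
  have : CompleteSpace (LinearMap.range (graphSum T : T.graph →ₗ[ℂ] E)) := hc.completeSpace_coe
  suffices h : LinearMap.range (graphSum T : T.graph →ₗ[ℂ] E) = ⊤ from LinearMap.range_eq_top.1 h
  rw [← Submodule.orthogonal_eq_bot_iff, Submodule.eq_bot_iff]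
  intro y hy
  rw [Submodule.mem_orthogonal] at hy
  -- A vector orthogonal to the closed range of `1 + T` satisfies `T y = -y`, which positivity
  -- forbids unless `y = 0`.
  have hmem : (y, -y) ∈ T.graph := by
    rw [mem_graph_iff_of_isSelfAdjoint hT]
    intro a b hab
    have := hy (a + b) ⟨⟨(a, b), hab⟩, rfl⟩
    rw [inner_add_left] at this
    rw [inner_neg_right]
    linear_combination this
  have h0 := hpos.re_inner_nonneg hmem
  rw [inner_neg_right, Complex.neg_re] at h0
  have h1 : (inner ℂ y y).re = ‖y‖ ^ 2 := by
    simpa using inner_self_eq_norm_sq (𝕜 := ℂ) y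
  have : ‖y‖ ^ 2 ≤ 0 := by linarith
  simpa using pow_eq_zero_iff (two_ne_zero) |>.1 (le_antisymm this (sq_nonneg _))

/-- The resolvent `B = (1 + T)⁻¹` of a positive selfadjoint operator. -/
theorem exists_resolvent (hT : IsSelfAdjoint T) (hpos : IsPositive T) :
    ∃ B : E →L[ℂ] E, B.IsPositive ∧ (1 - B).IsPositive ∧ Function.Injective B ∧
      ∀ x y, (x, y) ∈ T.graph ↔ ∃ w, B w = x ∧ (1 - B) w = y := by
  have : CompleteSpace T.graph := hT.isClosed.completeSpace_coe
  let e := ContinuousLinearEquiv.ofBijective (graphSum T)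
    (LinearMap.ker_eq_bot.2 (antilipschitzWith_graphSum hpos).injective)
    (LinearMap.range_eq_top.2 (surjective_graphSum hT hpos))
  have he (w : E) : (e.symm w).1.1 + (e.symm w).1.2 = w := e.apply_symm_apply w
  let B : E →L[ℂ] E := ContinuousLinearMap.fst ℂ E E ∘L T.graph.subtypeL ∘L
    (e.symm : E →L[ℂ] T.graph)
  have hB (w : E) : (B w, w - B w) ∈ T.graph := by
    have h : (B w, w - B w) = (e.symm w).1 := by
      ext
      · rfl
      · exact sub_eq_of_eq_add' (he w).symm
    rw [h]
    exact (e.symm w).2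
  have hB' {x y : E} (h : (x, y) ∈ T.graph) : B (x + y) = x := by
    have : e.symm (x + y) = ⟨(x, y), h⟩ := e.symm_apply_apply ⟨(x, y), h⟩
    change (e.symm (x + y)).1.1 = x
    rw [this]
  have hsymm (v w : E) : inner ℂ (B v) w = inner ℂ v (B w) := by
    have := (mem_graph_iff_of_isSelfAdjoint hT _ _).1 (hB w) _ _ (hB v)
    rw [inner_sub_left, inner_sub_right] at this
    linear_combination -this
  have hre (w : E) : 0 ≤ (inner ℂ (B w) (w - B w)).re := hpos.re_inner_nonneg (hB w)
  have hself (v : E) : (inner ℂ v v).re = ‖v‖ ^ 2 := by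
    simpa using inner_self_eq_norm_sq (𝕜 := ℂ) v
  refine ⟨B, ⟨fun v w => hsymm v w, fun w => ?_⟩, ⟨fun v w => ?_, fun w => ?_⟩, ?_, fun x y => ?_⟩
  · have h := hre w
    rw [inner_sub_right, Complex.sub_re, hself] at h
    change 0 ≤ (inner ℂ (B w) w).re
    nlinarith [sq_nonneg ‖B w‖]
  · change inner ℂ (v - B v) w = inner ℂ v (w - B w)
    rw [inner_sub_left, inner_sub_right, hsymm]
  · change 0 ≤ (inner ℂ (w - B w) w).re
    have h : inner ℂ (w - B w) w = inner ℂ (w - B w) (w - B w) + inner ℂ (B w) (w - B w) := by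
      rw [← inner_add_left, sub_add_cancel, inner_sub_left, inner_sub_right, hsymm]
    rw [h, Complex.add_re, hself]
    have := hre w
    positivity
  · rw [injective_iff_map_eq_zero]
    intro w hw
    have h := hB w
    rw [hw, sub_zero] at h
    exact T.graph_fst_eq_zero_snd h rfl
  · constructor
    · intro h
      refine ⟨x + y, hB' h, ?_⟩
      change x + y - B (x + y) = y
      rw [hB' h, add_sub_cancel_left]
    · rintro ⟨w, rfl, rfl⟩
      exact hB w

end SelfAdjoint

/-! ### Existence and null-space of the square root -/

section Sqrt

variable [CompleteSpace E]

/-- Commuting positive square roots of `B` and `1 - B`. -/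
theorem exists_commuting_sqrt {B : E →L[ℂ] E} (h0 : B.IsPositive) (h1 : (1 - B).IsPositive) :
    ∃ R K : E →L[ℂ] E, R.IsPositive ∧ K.IsPositive ∧ Commute R K ∧ (R * K).IsPositive ∧
      R * R = B ∧ K * K = 1 - B := by
  rw [← ContinuousLinearMap.nonneg_iff_isPositive] at h0 h1
  have hc : Commute (CFC.sqrt B) (CFC.sqrt (1 - B)) := by
    have h : Commute B (1 - B) := (Commute.one_right B).sub_right (Commute.refl B)
    exact ((h.cfcₙ_nnreal _).symm.cfcₙ_nnreal _).symm
  simp only [← ContinuousLinearMap.nonneg_iff_isPositive]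
  exact ⟨CFC.sqrt B, CFC.sqrt (1 - B), CFC.sqrt_nonneg _, CFC.sqrt_nonneg _, hc,
    hc.mul_nonneg (CFC.sqrt_nonneg _) (CFC.sqrt_nonneg _), CFC.sqrt_mul_sqrt_self B,
    CFC.sqrt_mul_sqrt_self (1 - B)⟩

/-- A positive selfadjoint operator has a positive selfadjoint square root. With
`R = (1 + M)^{-1/2}` and `K = (1 - R²)^{1/2}`, it is the operator `R u ↦ K u`. -/
theorem exists_isPositiveSqrt {M : E →ₗ.[ℂ] E} (hM : IsSelfAdjoint M) (hpos : IsPositive M) :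
    ∃ S : E →ₗ.[ℂ] E, IsPositiveSqrt S M := by
  obtain ⟨B, hB0, hB1, hBinj, hBM⟩ := exists_resolvent hM hpos
  obtain ⟨R, K, hR, hK, hRK, hRKpos, hRR, hKK⟩ := exists_commuting_sqrt hB0 hB1
  have hRR' (u : E) : R (R u) = B u := congr($hRR u)
  have hKK' (u : E) : K (K u) = (1 - B) u := congr($hKK u)
  have hcomm (u : E) : R (K u) = K (R u) := congr($(hRK.eq) u)
  have hsum (u : E) : R (R u) + K (K u) = u := by
    rw [hRR', hKK']; simp
  have hRinj {u : E} (h : R u = 0) : u = 0 := by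
    apply hBinj
    rw [← hRR', h, map_zero, map_zero]
  let g : Submodule ℂ (E × E) := LinearMap.range (R.prod K : E →ₗ[ℂ] E × E)
  have hg (x y : E) : (x, y) ∈ g ↔ ∃ u, R u = x ∧ K u = y := by
    simp [g, LinearMap.mem_range]
  have hgraph : g.toLinearPMap.graph = g := by
    apply Submodule.toLinearPMap_graph_eq
    rintro ⟨x, y⟩ hxy rfl
    obtain ⟨u, hu, rfl⟩ := (hg _ _).1 hxy
    rw [hRinj hu, map_zero]
  have hdense : Dense (g.toLinearPMap.domain : Set E) := by
    rw [Submodule.dense_iff_topologicalClosure_eq_top,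
      Submodule.topologicalClosure_eq_top_iff, Submodule.eq_bot_iff]
    intro y hy
    rw [Submodule.mem_orthogonal] at hy
    apply hRinj
    refine ext_inner_left ℂ fun v => ?_
    rw [inner_zero_right, ← hR.inner_left_eq_inner_right]
    apply hy
    rw [LinearPMap.mem_domain_iff]
    exact ⟨K v, hgraph.ge ((hg _ _).2 ⟨v, rfl, rfl⟩)⟩
  refine ⟨g.toLinearPMap, ?_, ?_, ?_⟩
  · rw [LinearPMap.isSelfAdjoint_def]
    apply LinearPMap.eq_of_eq_graph
    rw [LinearPMap.adjoint_graph_eq_graph_adjoint hdense, hgraph]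
    ext ⟨x, y⟩
    simp only [Submodule.mem_adjoint_iff, sub_eq_zero, hg]
    constructor
    · intro h
      have hxy : K x = R y := by
        refine ext_inner_left ℂ fun v => ?_
        rw [← hR.inner_left_eq_inner_right, ← hK.inner_left_eq_inner_right]
        exact h _ _ ⟨v, rfl, rfl⟩
      -- If `x = R u` and `y = K u`, then `R² + K² = 1` forces `u = R x + K y`.
      refine ⟨R x + K y, ?_, ?_⟩
      · rw [map_add, hcomm, ← hxy, hsum]
      · rw [map_add, ← hcomm, hxy, hsum]
    · rintro ⟨u, rfl, rfl⟩ a b ⟨v, rfl, rfl⟩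
      rw [hK.inner_left_eq_inner_right, hR.inner_left_eq_inner_right, hcomm]
  · intro x
    have hx := g.toLinearPMap.mem_graph x
    rw [hgraph, hg] at hx
    obtain ⟨u, hu, hu'⟩ := hx
    rw [← hu, ← hu', hR.inner_left_eq_inner_right]
    exact hRKpos.re_inner_nonneg_right u
  · intro x y
    simp only [hgraph, hg, hBM]
    constructor
    · rintro ⟨w, rfl, rfl⟩
      exact ⟨K (R w), ⟨R w, hRR' w, rfl⟩, ⟨K w, hcomm w, hKK' w⟩⟩
    · rintro ⟨z, ⟨u, rfl, rfl⟩, ⟨v, huv, rfl⟩⟩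
      refine ⟨R u + K v, ?_, ?_⟩
      · rw [← hRR', map_add, hcomm v, huv, hsum]
      · rw [← hKK', map_add, ← hcomm u, ← huv, hsum]

theorem isPositiveSqrt_sqrtOp {M : E →ₗ.[ℂ] E} (hM : IsSelfAdjoint M) (hpos : IsPositive M) :
    IsPositiveSqrt (sqrtOp M) M := by
  have h := exists_isPositiveSqrt hM hpos
  rw [sqrtOp, dif_pos h]
  exact Classical.choose_spec h

/-- If `S (S x) = 0`, then `‖S x‖² = (x, S (S x)) = 0`. -/
theorem IsPositiveSqrt.nullSpace_eq {S M : E →ₗ.[ℂ] E} (h : IsPositiveSqrt S M) :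
    nullSpace S = nullSpace M := by
  obtain ⟨hS, -, hSM⟩ := h
  ext x
  rw [mem_nullSpace_iff, mem_nullSpace_iff, hSM]
  constructor
  · intro hx
    exact ⟨0, hx, S.graph.zero_mem⟩
  · rintro ⟨z, hxz, hz⟩
    have h0 := (mem_graph_iff_of_isSelfAdjoint hS _ _).1 hz _ _ hxz
    rw [inner_zero_right, inner_self_eq_zero] at h0
    rwa [h0] at hxz

end Sqrt

/-! ### The block operator and sectorial forms -/

theorem mem_nullSpace_blockOp_iff (S : E →ₗ.[ℂ] E) (C : E →L[ℂ] E) (p : WithLp 2 (E × E)) :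
    p ∈ nullSpace (blockOp S C) ↔ p.fst ∈ nullSpace S ∧ (p.snd, -(C p.fst)) ∈ S.graph := by
  simp only [mem_nullSpace_iff, LinearPMap.mem_graph_iff]
  constructor
  · rintro ⟨q, rfl, hq⟩
    have hq' : WithLp.toLp 2 (-(C q.1.fst) - S ⟨q.1.snd, q.2.2⟩, S ⟨q.1.fst, q.2.1⟩) =
      (0 : WithLp 2 (E × E)) := hq
    have h1 : -(C q.1.fst) - S ⟨q.1.snd, q.2.2⟩ = 0 := congr(($hq').fst)
    have h2 : S ⟨q.1.fst, q.2.1⟩ = 0 := congr(($hq').snd)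
    exact ⟨⟨_, rfl, h2⟩, ⟨_, rfl, (sub_eq_zero.1 h1).symm⟩⟩
  · rintro ⟨⟨a, ha, ha'⟩, ⟨b, hb, hb'⟩⟩
    obtain ⟨a, hma⟩ := a
    obtain ⟨b, hmb⟩ := b
    dsimp only at ha hb
    subst ha hb
    refine ⟨⟨p, ⟨hma, hmb⟩⟩, rfl, ?_⟩
    change WithLp.toLp 2 (-(C p.fst) - S ⟨p.snd, hmb⟩, S ⟨p.fst, hma⟩) = 0
    rw [ha', hb', sub_self]
    rfl

theorem mem_orthSum_iff (U V : Submodule ℂ E) (p : WithLp 2 (E × E)) :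
    p ∈ orthSum U V ↔ p.fst ∈ U ∧ p.snd ∈ V := Iff.rfl

/-- If `a t + b t² ≥ 0` for all real `t`, then `a = 0`. -/
theorem eq_zero_of_forall_mul_add_mul_sq_nonneg {a b : ℝ} (h : ∀ t : ℝ, 0 ≤ a * t + b * t ^ 2) :
    a = 0 := by
  by_contra ha
  have hb : 0 < |b| + 1 := by positivity
  -- The sign of `t` is opposite to that of `a`, and `|b| + 1 > b` lets the linear term win.
  have h1 := h (-a / (|b| + 1))
  have h2 : a * (-a / (|b| + 1)) + b * (-a / (|b| + 1)) ^ 2 =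
      a ^ 2 * (b - (|b| + 1)) / (|b| + 1) ^ 2 := by
    field_simp
    ring
  rw [h2] at h1
  have h3 : a ^ 2 * (b - (|b| + 1)) < 0 :=
    mul_neg_of_pos_of_neg (by positivity) (by linarith [le_abs_self b])
  have := div_neg_of_neg_of_pos h3 (by positivity : 0 < (|b| + 1) ^ 2)
  linarith

/-- A sectorial operator annihilates every zero of its quadratic form. -/
theorem IsSectorial.apply_eq_zero {C : E →L[ℂ] E} (hC : IsSectorial C) {x : E}
    (hx : inner ℂ x (C x) = 0) : C x = 0 := by
  obtain ⟨N, hN, hC⟩ := hC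
  have hre (v : E) : 0 ≤ (inner ℂ v (C v)).re :=
    nonneg_of_mul_nonneg_right ((abs_nonneg _).trans (hC v)) hN
  have expand (y : E) (t : ℝ) : inner ℂ (x + (t : ℂ) • y) (C (x + (t : ℂ) • y)) =
      t * (inner ℂ x (C y) + inner ℂ y (C x)) + t ^ 2 * inner ℂ y (C y) := by
    simp only [map_add, map_smul, inner_add_left, inner_add_right, inner_smul_left,
      inner_smul_right, hx, Complex.conj_ofReal]
    ring
  have key (y : E) : inner ℂ x (C y) + inner ℂ y (C x) = 0 := by
    have hR : (inner ℂ x (C y) + inner ℂ y (C x)).re = 0 := by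
      apply eq_zero_of_forall_mul_add_mul_sq_nonneg (b := (inner ℂ y (C y)).re)
      intro t
      have h := hre (x + (t : ℂ) • y)
      rw [expand] at h
      norm_cast at h
      simp only [Complex.add_re, Complex.re_ofReal_mul] at h ⊢
      linarith
    apply Complex.ext hR
    -- With the real linear term gone, `-Im ≤ N Re` has only the imaginary part as its linear
    -- coefficient.
    apply eq_zero_of_forall_mul_add_mul_sq_nonneg
      (b := N * (inner ℂ y (C y)).re + (inner ℂ y (C y)).im)
    intro t
    have h := (neg_le_abs _).trans (hC (x + (t : ℂ) • y))
    rw [expand, ← Complex.ofReal_pow, Complex.add_im, Complex.add_re, Complex.im_ofReal_mul,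
      Complex.re_ofReal_mul, hR, Complex.im_ofReal_mul, Complex.re_ofReal_mul] at h
    linarith
  have hzero (y : E) : inner ℂ y (C x) = 0 := by
    have h1 := key y
    -- Replacing `y` by `i y` flips the relative sign of the two terms and so separates them.
    have h2 := key (Complex.I • y)
    rw [map_smul, inner_smul_left, inner_smul_right, Complex.conj_I] at h2
    have h3 : Complex.I * (2 * inner ℂ y (C x)) = 0 := by linear_combination Complex.I * h1 - h2
    simpa using h3
  exact inner_self_eq_zero.1 (hzero (C x))

end DampedSystem

theorem mainTheorem9 {Y : Type*} [NormedAddCommGroup Y] [InnerProductSpace ℂ Y] [CompleteSpace Y]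
    (M : Y →ₗ.[ℂ] Y) (hM : IsSelfAdjoint M) (hMpos : DampedSystem.IsPositive M)
    (C : Y →L[ℂ] Y) (hC : DampedSystem.IsAccretive C) :
    DampedSystem.orthSum (LinearMap.ker (C : Y →ₗ[ℂ] Y) ⊓ DampedSystem.nullSpace M)
        (DampedSystem.nullSpace M) ≤ DampedSystem.nullSpace (DampedSystem.Aplus M C) ∧
      (DampedSystem.IsSectorial C →
        DampedSystem.nullSpace (DampedSystem.Aplus M C) =
          DampedSystem.orthSum (LinearMap.ker (C : Y →ₗ[ℂ] Y) ⊓ DampedSystem.nullSpace M)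
            (DampedSystem.nullSpace M)) := by
  have hS := DampedSystem.isPositiveSqrt_sqrtOp hM hMpos
  have hle : DampedSystem.orthSum (LinearMap.ker (C : Y →ₗ[ℂ] Y) ⊓ DampedSystem.nullSpace M)
      (DampedSystem.nullSpace M) ≤ DampedSystem.nullSpace (DampedSystem.Aplus M C) := by
    rintro p ⟨⟨hp, hp1⟩, hp2⟩
    replace hp : C p.fst = 0 := hp
    rw [← hS.nullSpace_eq] at hp1 hp2
    rw [DampedSystem.Aplus, DampedSystem.mem_nullSpace_blockOp_iff, hp, neg_zero,
      ← DampedSystem.mem_nullSpace_iff]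
    exact ⟨hp1, hp2⟩
  refine ⟨hle, fun hsec => le_antisymm (fun p hp => ?_) hle⟩
  rw [DampedSystem.Aplus, DampedSystem.mem_nullSpace_blockOp_iff] at hp
  obtain ⟨hp1, hp2⟩ := hp
  have hform : inner ℂ p.fst (C p.fst) = 0 := by
    have h := (DampedSystem.mem_graph_iff_of_isSelfAdjoint hS.1 _ _).1 hp2 _ _
      ((DampedSystem.mem_nullSpace_iff _ _).1 hp1)
    rw [inner_zero_left, inner_neg_right] at h
    exact neg_eq_zero.1 h.symm
  have hCp := hsec.apply_eq_zero hform
  rw [hCp, neg_zero, ← DampedSystem.mem_nullSpace_iff] at hp2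
  rw [DampedSystem.mem_orthSum_iff, ← hS.nullSpace_eq]
  exact ⟨⟨hCp, hp1⟩, hp2⟩
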